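/- Conventions. Let $A$ be a unital $C^*$-algebra, $S$ an abelian semigroup with identity $e$, and $\operatorname{End}(A)$ the monoid of (not necessarily unital) $*$-endomorphisms of $A$. An action of $S$ is a unital semigroup homomorphism into $\operatorname{End}(A)$. A transfer operator for $\phi\in\operatorname{End}(A)$ is a continuous positive linear map $T:A\to A$ with $T(\phi(a)x)=aT(x)$ for all $a,x\in A$. Let $\alpha: S\to \operatorname{End}(A)$ be an action, and let $L:S\to \operatorname{End}(A)$ be an action such that each $L_s$ is a transfer operator for $\alpha_s$. A Toeplitz covariant representation of $(A,S,\alpha,L)$ on a Hilbert space $H$ is a pair $(\pi,V)$ of a unital $*$-representation $\pi:A\to B(H)$ and a map $V:S\to B(H)$ with $V_e=1$ and $V_{st}=V_sV_t$, such that $V_s\pi(a)=\pi(\alpha_s(a))V_s$ and $V_s^*\pi(a)V_s=\pi(L_s(a))$ for all $s\in S$, $a\in A$. A Toeplitz crossed product for $(A,S,\alpha,L)$ is a unital $C^*$-algebra $B$ with a unital $*$-homomorphism $i_A:A\to B$ and a unital semigroup homomorphism $i_S:S\to B$ such that (i) for each unital representation $\sigma$ of $B$ on a Hilbert space, $(\sigma\circ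 i_A,\sigma\circ i_S)$ is a Toeplitz covariant representation; (ii) for each Toeplitz covariant representation $(\pi,V)$ there is a representation $\rho$ of $B$ with $\rho\circ i_A=\pi$ and $\rho\circ i_S=V$; (iii) $B$ is generated as a $C^*$-algebra by $\{i_A(a)i_S(s): a\in A, s\in S\}$. Let $I$ be the closed two-sided ideal of $B$ generated by all $a-k$ for which there is $s\in S$ such that $a\in i_A(A)$ lies in the closed linear span of $i_A(A\alpha_s(A)A)$, $k$ lies in the closed linear span of $i_A(A)i_S(s)i_S(s)^*i_A(A)$, and $a\,i_A(b)i_S(s)=k\,i_A(b)i_S(s)$ for all $b\in A$. The crossed product is $A\rtimes_{\alpha,L}S:=B/I$; let $j_A$, $j_S$ be the compositions of $i_A$, $i_S$ with the quotient map. Theorem. Let $A$ be a unital $C^*$-algebra, $S$ an abelian semigroup with identity, and $\beta,L:S\to\operatorname{End}(A)$ actions such that $\beta_s(1)=1$, $L_s$ is a transfer operator for $\beta_s$, and $\beta_s\circ L_s=\operatorname{id}$, for all $s\in S$. Then each $\beta_s$ is a transfer operator for $L_s$. On every Hilbert space, the map $(\pi,V)\mapsto(\pi,V^*)$, where $(V^*)_s:=V_s^*$,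 is a bijection from the set of Toeplitz covariant representations $(\pi,V)$ of $(A,S,L,\beta)$ which satisfy $$V_s\pi(a)V_s^*=\pi(L_s(a))\quad\text{for all } s\in S,\ a\in A$$ onto the set of Toeplitz covariant representations $(\pi,W)$ of $(A,S,\beta,L)$ which satisfy $$\pi(a)=\pi(a)W_sW_s^*\quad\text{for all } s\in S,\ a\in A$$ (that is, $\pi(a)=\pi(a)V_s^*V_s$ when $W=V^*$). Moreover, Toeplitz crossed products for $(A,S,L,\beta)$ and for $(A,S,\beta,L)$ exist and, for any choice of them, the bijection induces an (isometric) $*$-isomorphism $$\Phi: A\rtimes_{L,\beta}S\to A\rtimes_{\beta,L}S,\qquad \Phi(j_A(a))=j_A(a),\quad \Phi(j_S(s))=j_S(s)^*;$$ every $(\pi,V)$ in the first set gives representations $\rho_1$ of $A\rtimes_{L,\beta}S$ with $\rho_1\circ j_A=\pi$, $\rho_1\circ j_S=V$ and $\rho_2$ of $A\rtimes_{\beta,L}S$ with $\rho_2\circ j_A=\pi$, $\rho_2\circ j_S=V^*$, and $\rho_2\circ\Phi=\rho_1$. -/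

import Mathlib

universe u v w

/-- `T` is a transfer operator for the endomorphism `φ` of the unital C*-algebra `A`: a continuous
positive linear map with `T (φ a * x) = a * T x`. Positive elements are those of the form
`star b * b`. As `A` is unital, `M(A) = A`, and no extension of `φ` or `T` is involved. -/
structure IsTransferOperator {A : Type u} [CStarAlgebra A] (φ : A →⋆ₙₐ[ℂ] A) (T : A → A) :
    Prop where
  isLinear : IsLinearMap ℂ T
  continuous : Continuous T
  positive : ∀ a : A, ∃ b : A, T (star a * a) = star b * b
  transfer : ∀ a x : A, T (φ a * x) = a * T x

/-- `(π, V)` is a Toeplitz covariant representation of `(A, S, α, L)` on the Hilbert space `H`.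
As `A` is unital, a representation of `A` on `H` is non-degenerate iff it is unital. -/
structure IsToeplitzCovariant {A : Type u} [CStarAlgebra A] {S : Type v} [CommMonoid S]
    {H : Type w} [NormedAddCommGroup H] [InnerProductSpace ℂ H] [CompleteSpace H]
    (α : S → (A →⋆ₙₐ[ℂ] A)) (L : S → A → A)
    (π : A →⋆ₐ[ℂ] (H →L[ℂ] H)) (V : S →* (H →L[ℂ] H)) : Prop where
  tc1 : ∀ (s : S) (a : A), V s * π a = π (α s a) * V s
  tc2 : ∀ (s : S) (a : A), star (V s) * π a * V s = π (L s a)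

/-- The representation `s ↦ (V s)*` of the abelian semigroup `S`. -/
noncomputable def adjointRep {S : Type v} [CommMonoid S] {H : Type w} [NormedAddCommGroup H]
    [InnerProductSpace ℂ H] [CompleteSpace H] (V : S →* (H →L[ℂ] H)) : S →* (H →L[ℂ] H) where
  toFun s := star (V s)
  map_one' := by simp
  map_mul' s t := by rw [mul_comm s t, map_mul, star_mul]

/-- A Toeplitz crossed product `(B, i_A, i_S)` for `(A, S, α, L)`. As `A` is unital and `i_A` is
non-degenerate, `i_A 1` is a unit of `B`; so `B = M(B)` is unital, and `i_A` and the non-degenerate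
representations of `B` are unital. -/
structure ToeplitzCrossedProduct {A : Type u} [CStarAlgebra A] {S : Type v} [CommMonoid S]
    (α : S → (A →⋆ₙₐ[ℂ] A)) (L : S → A → A) where
  /-- the underlying C*-algebra `B` -/
  Carrier : Type (max u v)
  [cstar : CStarAlgebra Carrier]
  /-- the homomorphism `i_A` -/
  iA : A →⋆ₐ[ℂ] Carrier
  /-- the representation `i_S` -/
  iS : S →* Carrier
  covariant : ∀ (H : Type (max u v)) [NormedAddCommGroup H] [InnerProductSpace ℂ H]
    [CompleteSpace H] (σ : Carrier →⋆ₐ[ℂ] (H →L[ℂ] H)),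
    IsToeplitzCovariant α L (σ.comp iA) ((σ : Carrier →* (H →L[ℂ] H)).comp iS)
  universal : ∀ (H : Type (max u v)) [NormedAddCommGroup H] [InnerProductSpace ℂ H]
    [CompleteSpace H] (π : A →⋆ₐ[ℂ] (H →L[ℂ] H)) (V : S →* (H →L[ℂ] H)),
    IsToeplitzCovariant α L π V →
      ∃ ρ : Carrier →⋆ₐ[ℂ] (H →L[ℂ] H), (∀ a, ρ (iA a) = π a) ∧ ∀ s, ρ (iS s) = V s
  generated : (StarAlgebra.adjoin ℂ
    {x : Carrier | ∃ (a : A) (s : S), x = iA a * iS s}).topologicalClosure = ⊤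

namespace ToeplitzCrossedProduct

attribute [instance] ToeplitzCrossedProduct.cstar

variable {A : Type u} [CStarAlgebra A] {S : Type v} [CommMonoid S]
  {α : S → (A →⋆ₙₐ[ℂ] A)} {L : S → A → A} (T : ToeplitzCrossedProduct α L)

/-- The closed linear span of `i_A(A) i_S(s) i_S(s)* i_A(A)`. -/
noncomputable def compactPart (s : S) : Submodule ℂ T.Carrier :=
  (Submodule.span ℂ
    {x | ∃ a b : A, x = T.iA a * T.iS s * star (T.iS s) * T.iA b}).topologicalClosure

/-- The closed linear span of `i_A(A α_s(A) A)`. -/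
noncomputable def idealPart (s : S) : Submodule ℂ T.Carrier :=
  (Submodule.span ℂ {x | ∃ a b c : A, x = T.iA (a * α s b * c)}).topologicalClosure

/-- `(a, k)` is a redundancy at `s`. -/
structure IsRedundancy (s : S) (a k : T.Carrier) : Prop where
  mem_range : a ∈ Set.range T.iA
  mem_compactPart : k ∈ T.compactPart s
  mul_eq : ∀ b : A, a * T.iA b * T.iS s = k * T.iA b * T.iS s

/-- The differences `a - k` for redundancies `(a, k)` with `a` in the closed span of
`i_A(A α_s(A) A)`. -/
def redundancyDiffs : Set T.Carrier :=
  {x | ∃ (s : S) (a k : T.Carrier), a ∈ T.idealPart s ∧ T.IsRedundancy s a k ∧ x = a - k}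

/-- The closed two-sided ideal generated by these differences. -/
def redundancyIdeal : Ideal T.Carrier :=
  sInf {J : Ideal T.Carrier |
    J.IsTwoSided ∧ IsClosed (J : Set T.Carrier) ∧ T.redundancyDiffs ⊆ J}

instance redundancyIdeal_isTwoSided : T.redundancyIdeal.IsTwoSided where
  mul_mem_of_left {a} b ha := by
    simp only [redundancyIdeal, Submodule.mem_sInf] at ha ⊢
    intro J hJ
    have := hJ.1
    exact Ideal.mul_mem_right b J (ha J hJ)

instance redundancyIdeal_isClosed : IsClosed (T.redundancyIdeal : Set T.Carrier) := by
  rw [redundancyIdeal, Submodule.coe_sInf]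
  exact isClosed_biInter fun J hJ => hJ.2.1

theorem star_mem_closure_span {B : Type*} [CStarAlgebra B] {X : Set B}
    (hX : ∀ x ∈ X, star x ∈ X) {x : B} (hx : x ∈ (Submodule.span ℂ X).topologicalClosure) :
    star x ∈ (Submodule.span ℂ X).topologicalClosure := by
  rw [← SetLike.mem_coe, Submodule.topologicalClosure_coe] at hx ⊢
  refine map_mem_closure continuous_star hx fun y hy => ?_
  induction hy using Submodule.span_induction with
  | mem y hy => exact Submodule.subset_span (hX y hy)
  | zero => simp
  | add y z _ _ hy hz => simpa using add_mem hy hz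
  | smul c y _ hy => simpa using Submodule.smul_mem _ (star c) hy

theorem star_mem_redundancyDiffs {x : T.Carrier} (hx : x ∈ T.redundancyDiffs) :
    star x ∈ T.redundancyDiffs := by
  obtain ⟨s, a, k, ha, ⟨⟨a', rfl⟩, hk, h⟩, rfl⟩ := hx
  have hk' : star k ∈ T.compactPart s := by
    refine star_mem_closure_span ?_ hk
    rintro _ ⟨b, c, rfl⟩
    exact ⟨star c, star b, by simp [mul_assoc, map_star]⟩
  refine ⟨s, star (T.iA a'), star k, ?_, ⟨⟨star a', map_star _ _⟩, hk', ?_⟩, star_sub _ _⟩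
  · refine star_mem_closure_span ?_ ha
    rintro _ ⟨b, c, d, rfl⟩
    exact ⟨star d, star c, star b, by rw [← map_star]; simp [mul_assoc, map_star]⟩
  · intro b
    have h0 : ∀ c : A, (T.iA a' - k) * T.iA c * T.iS s = 0 := fun c => by
      rw [sub_mul, sub_mul, h c, sub_self]
    have h1 : ∀ y ∈ T.compactPart s, (T.iA a' - k) * y = 0 := by
      intro y hy
      have hcl : IsClosed {y : T.Carrier | (T.iA a' - k) * y = 0} :=
        isClosed_eq (by fun_prop) continuous_const
      refine closure_minimal ?_ hcl hy
      intro y hy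
      induction hy using Submodule.span_induction with
      | mem y hy =>
        obtain ⟨c, d, rfl⟩ := hy
        have := h0 c
        simp only [Set.mem_ofPred_eq, ← mul_assoc, this, zero_mul]
      | zero => simp
      | add y z _ _ hy hz =>
        simp only [Set.mem_ofPred_eq] at hy hz ⊢
        rw [mul_add, hy, hz, add_zero]
      | smul c y _ hy =>
        simp only [Set.mem_ofPred_eq] at hy ⊢
        rw [mul_smul_comm, hy, smul_zero]
    have h2 : (T.iA a' - k) * (star (T.iA a' - k) * T.iA b * T.iS s) = 0 := by
      have e1 := h0 (star a' * b)
      rw [map_mul, map_star] at e1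
      rw [star_sub, sub_mul (star (T.iA a')), sub_mul (star (T.iA a') * T.iA b), mul_sub]
      have e2 : (T.iA a' - k) * (star k * T.iA b * T.iS s) = 0 := by
        rw [← mul_assoc, ← mul_assoc, h1 _ hk', zero_mul, zero_mul]
      rw [e2, sub_zero, ← e1]
      simp only [mul_assoc]
    have h3 : star (star (T.iA a' - k) * T.iA b * T.iS s) *
        (star (T.iA a' - k) * T.iA b * T.iS s) = 0 := by
      nth_rewrite 1 [star_mul, star_mul, star_star]
      rw [mul_assoc, mul_assoc, h2, mul_zero, mul_zero]
    have h4 := CStarRing.star_mul_self_eq_zero_iff _ |>.1 h3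
    rwa [star_sub, sub_mul, sub_mul, sub_eq_zero] at h4

/-- The ideal of redundancies is self-adjoint, so that the quotient by it is a `*`-algebra. -/
theorem star_mem_redundancyIdeal {x : T.Carrier} (hx : x ∈ T.redundancyIdeal) :
    star x ∈ T.redundancyIdeal := by
  simp only [redundancyIdeal, Submodule.mem_sInf] at hx ⊢
  intro J hJ
  have := hJ.1
  let J' : Ideal T.Carrier :=
    { carrier := {y | star y ∈ J}
      add_mem' := fun {y z} hy hz => by
        simp only [Set.mem_ofPred_eq, star_add] at *
        exact J.add_mem hy hz
      zero_mem' := by simp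
      smul_mem' := fun c y hy => by
        simp only [Set.mem_ofPred_eq, smul_eq_mul, star_mul] at *
        exact Ideal.mul_mem_right _ J hy }
  refine hx J' ⟨⟨fun {a} b ha => ?_⟩, hJ.2.1.preimage continuous_star, fun y hy =>
    hJ.2.2 (T.star_mem_redundancyDiffs hy)⟩
  change star (a * b) ∈ J
  rw [star_mul]
  exact Ideal.mul_mem_left J _ ha

/-- The crossed product, i.e. the quotient of the Toeplitz crossed product by the ideal of
redundancies, with the quotient operations and the quotient norm. -/
abbrev CrossedProduct : Type (max u v) := T.Carrier ⧸ T.redundancyIdeal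

noncomputable instance crossedProductStarRing : StarRing T.CrossedProduct where
  star := Quotient.map' star fun x y hxy => by
    rw [Submodule.quotientRel_def] at hxy ⊢
    rw [← star_sub]
    exact T.star_mem_redundancyIdeal hxy
  star_involutive := by
    rintro ⟨x⟩
    exact congrArg (Ideal.Quotient.mk T.redundancyIdeal) (star_star x)
  star_mul := by
    rintro ⟨x⟩ ⟨y⟩
    exact congrArg (Ideal.Quotient.mk T.redundancyIdeal) (star_mul x y)
  star_add := by
    rintro ⟨x⟩ ⟨y⟩
    exact congrArg (Ideal.Quotient.mk T.redundancyIdeal) (star_add x y)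

/-- The quotient map onto the crossed product. -/
noncomputable def quot : T.Carrier →⋆ₐ[ℂ] T.CrossedProduct :=
  { Ideal.Quotient.mkₐ ℂ T.redundancyIdeal with map_star' := fun _ => rfl }

/-- The canonical map `A → A ⋊ S`. -/
noncomputable def jA (a : A) : T.CrossedProduct := T.quot (T.iA a)

/-- The canonical map `S → A ⋊ S`. -/
noncomputable def jS (s : S) : T.CrossedProduct := T.quot (T.iS s)

end ToeplitzCrossedProduct

/-! Write `V` for the semigroup in the system with action `L` and transfer operator `β`, and `W` for
the semigroup in the reversed system. Since `β s 1 = 1`, each `V s` is an isometry. The transfer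
identity and its adjoint give `L s 1 * a = L s (β s a) = a * L s 1`, so `L s 1` is central. Hence,
once `V V* = π (L s 1)`, the relations of the two systems are exchanged by taking adjoints, with `W
= V*` a coisometry.

Redundancies impose exactly these extra relations. From `V V* b V = V β(b) = L(1) b V`, the pair `(L
s 1, V V*)` is a redundancy; from `W W* b W = W L(b) = b W`, so is `(1, W W*)`. Conversely, if `V V*
= L(1)` or `W W* = 1` holds, both entries of an admissible redundancy absorb the range projection on
the right, so they agree (`IsRedundancy.map_eq`). The two quotients thus have universal properties
that taking adjoints interchanges, and the resulting maps are mutually inverse on generators.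

The rest is C*-algebraic groundwork. GNS representations turn a universal property for Hilbert
spaces into one for C*-algebras (`exists_lift`), approximate units make the quotient a C*-algebra,
and the Toeplitz algebra is generated inside a bounded product of representations. One
representation is chosen per seminorm on noncommutative polynomials, so that the product is indexed
by a set in the right universe. -/

/-! ### Positive functionals and separation by representations -/

section PositiveFunctionals

open scoped ComplexOrder CStarAlgebra

attribute [local instance] CStarAlgebra.spectralOrder CStarAlgebra.spectralOrderedRing

/-- A self-adjoint element of a C⋆-algebra which is not positive is detected by a positive
functional. -/
theorem CStarAlgebra.exists_positiveLinearMap_re_neg {B : Type u} [CStarAlgebra B] {x : B}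
    (hx : IsSelfAdjoint x) (hx' : ¬ 0 ≤ x) : ∃ f : B →ₚ[ℂ] ℂ, (f x).re < 0 := by
  have hconv : Convex ℝ {a : B | 0 ≤ a} := by
    intro a ha b hb s t hs ht _
    rw [Set.mem_ofPred_eq] at ha hb ⊢
    exact add_nonneg (smul_nonneg hs ha) (smul_nonneg ht hb)
  obtain ⟨g, r, hgx, hg⟩ := geometric_hahn_banach_point_closed hconv
    (CStarAlgebra.isClosed_nonneg (A := B)) hx'
  have hr : r < 0 := by simpa using hg 0 (le_refl (0 : B))
  -- The positive elements form a cone: if `g a < 0`, rescaling `a` gives a positive element with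
  -- value exactly `r`, against the strict separation.
  have hpos : ∀ a : B, 0 ≤ a → 0 ≤ g a := by
    intro a ha
    by_contra! hneg
    have h := hg ((r / g a) • a) (smul_nonneg (div_nonneg_of_nonpos hr.le hneg.le) ha)
    rw [map_smul, smul_eq_mul, div_mul_cancel₀ _ hneg.ne] at h
    exact lt_irrefl _ h
  -- Symmetrising makes `g'` vanish on skew-adjoint elements, so its complexification is real, equal
  -- to `2 * g`, on self-adjoint ones.
  let g' : StrongDual ℝ B := g + g.comp (starL' ℝ (A := B)).toContinuousLinearMap
  have hg' : ∀ a : B, g' a = g a + g (star a) := fun a => rfl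
  let F : StrongDual ℂ B := g'.extendRCLike
  have hF : ∀ a : B, IsSelfAdjoint a → F a = ((2 * g a : ℝ) : ℂ) := by
    intro a ha
    have h1 : F a = (g' a : ℂ) - Complex.I * (g' (Complex.I • a) : ℂ) :=
      StrongDual.extendRCLike_apply (𝕜 := ℂ) g' a
    rw [h1, hg', hg', star_smul, ha.star_eq]
    simp
    ring
  refine ⟨PositiveLinearMap.mk₀ F.toLinearMap fun a ha => ?_, ?_⟩
  · change 0 ≤ F a
    rw [hF a (.of_nonneg ha)]
    exact_mod_cast mul_nonneg zero_le_two (hpos a ha)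
  · change (F x).re < 0
    rw [hF x hx, Complex.ofReal_re]
    linarith

/-- The norm of an element of a C⋆-algebra is bounded by any bound for the norms of its images under
all representations on Hilbert spaces. -/
theorem CStarAlgebra.norm_le_of_forall_representation {B : Type u} [CStarAlgebra B] {x : B} {c : ℝ}
    (hc : 0 ≤ c) (h : ∀ (H : Type u) [NormedAddCommGroup H] [InnerProductSpace ℂ H]
      [CompleteSpace H] (σ : B →⋆ₐ[ℂ] (H →L[ℂ] H)), ‖σ x‖ ≤ c) : ‖x‖ ≤ c := by
  have hsa : IsSelfAdjoint (algebraMap ℝ B (c ^ 2) - star x * x) :=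
    (IsSelfAdjoint.algebraMap B (.all (c ^ 2))).sub (.star_mul_self x)
  have key : 0 ≤ algebraMap ℝ B (c ^ 2) - star x * x := by
    by_contra hneg
    obtain ⟨f, hf⟩ := CStarAlgebra.exists_positiveLinearMap_re_neg hsa hneg
    have hb := h f.GNS f.gnsStarAlgHom
    -- On the cyclic vector the operator bound reads `f (x* x) ≤ c² f 1`, contradicting negativity
    -- of `f` at `c² - x* x`.
    have h1 : f.gnsStarAlgHom x ((f.toPreGNS 1 : f.PreGNS) : f.GNS) =
        ((f.toPreGNS x : f.PreGNS) : f.GNS) := by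
      simp
    have h2 := (f.gnsStarAlgHom x).le_of_opNorm_le hb ((f.toPreGNS 1 : f.PreGNS) : f.GNS)
    rw [h1, UniformSpace.Completion.norm_coe, UniformSpace.Completion.norm_coe] at h2
    have h3 : ‖f.toPreGNS x‖ ^ 2 ≤ c ^ 2 * ‖f.toPreGNS 1‖ ^ 2 := by
      rw [← mul_pow]; gcongr
    have h4 : (f (star x * x)).re = ‖f.toPreGNS x‖ ^ 2 := by
      have := f.preGNS_norm_sq (f.toPreGNS x)
      rw [f.ofPreGNS_toPreGNS] at this
      rw [← this]; norm_cast
    have h5 : (f 1).re = ‖f.toPreGNS 1‖ ^ 2 := by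
      have := f.preGNS_norm_sq (f.toPreGNS 1)
      rw [f.ofPreGNS_toPreGNS, star_one, mul_one] at this
      rw [← this]; norm_cast
    have h6 : f (algebraMap ℝ B (c ^ 2)) = (c ^ 2 : ℝ) • f 1 := by
      rw [Algebra.algebraMap_eq_smul_one, ← Complex.coe_smul, map_smul, Complex.coe_smul]
    rw [map_sub, h6, Complex.sub_re, Complex.real_smul, Complex.re_ofReal_mul, h4, h5] at hf
    linarith
  have hle : star x * x ≤ algebraMap ℝ B (c ^ 2) := sub_nonneg.1 key
  have hn := (CStarAlgebra.norm_le_iff_le_algebraMap (star x * x) (sq_nonneg c)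
    (star_mul_self_nonneg x)).2 hle
  rw [CStarRing.norm_star_mul_self, ← sq] at hn
  exact (sq_le_sq₀ (norm_nonneg _) hc).1 hn

/-- Representations on Hilbert spaces separate the points of a C⋆-algebra. -/
theorem CStarAlgebra.eq_of_forall_representation {B : Type u} [CStarAlgebra B] {x y : B}
    (h : ∀ (H : Type u) [NormedAddCommGroup H] [InnerProductSpace ℂ H]
      [CompleteSpace H] (σ : B →⋆ₐ[ℂ] (H →L[ℂ] H)), σ x = σ y) : x = y := by
  rw [← sub_eq_zero, ← norm_le_zero_iff]
  exact CStarAlgebra.norm_le_of_forall_representation le_rfl fun H _ _ _ σ => by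
    rw [map_sub, h H σ, sub_self, norm_zero]

end PositiveFunctionals

/-! ### Quotients by closed self-adjoint ideals are C⋆-algebras -/

section Quotient

attribute [local instance] CStarAlgebra.spectralOrder CStarAlgebra.spectralOrderedRing

/-- Approximate units in a closed self-adjoint two-sided ideal. -/
theorem Ideal.exists_norm_sub_mul_lt {B : Type u} [CStarAlgebra B] (I : Ideal B) [I.IsTwoSided]
    (hI : IsClosed (I : Set B)) (hstar : ∀ x ∈ I, star x ∈ I) {y : B} (hy : y ∈ I)
    {ε : ℝ} (hε : 0 < ε) : ∃ e ∈ I, star e = e ∧ ‖1 - e‖ ≤ 1 ∧ ‖y - y * e‖ < ε := by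
  let J : NonUnitalStarSubalgebra ℂ B :=
    { carrier := I
      add_mem' := I.add_mem
      zero_mem' := I.zero_mem
      mul_mem' := fun {a b} _ hb => I.mul_mem_left a hb
      smul_mem' := fun c x hx => by
        have : c • x = (c • (1 : B)) * x := by simp
        rw [SetLike.mem_coe] at hx ⊢
        rw [this]
        exact I.mul_mem_left _ hx
      star_mem' := fun {a} ha => hstar a ha }
  have : IsClosed (J : Set B) := hI
  let _ : NonUnitalCStarAlgebra J := NonUnitalStarSubalgebra.nonUnitalCStarAlgebra J
  let _ : PartialOrder J := CStarAlgebra.spectralOrder J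
  have : StarOrderedRing J := CStarAlgebra.spectralOrderedRing J
  have hu := CStarAlgebra.increasingApproximateUnit J
  have hlim := hu.tendsto_mul_left (⟨y, hy⟩ : J)
  have hev := hlim.eventually (Metric.ball_mem_nhds _ hε)
  obtain ⟨e, he, hpos, hnorm⟩ := (hev.and (hu.eventually_nonneg.and hu.eventually_norm)).exists
  -- The order on `J` is its own spectral order; positivity passes to `B` through the form `b* b`.
  have hpos' : (0 : B) ≤ e := by
    obtain ⟨b, hb⟩ := CStarAlgebra.nonneg_iff_eq_star_mul_self.1 hpos
    rw [hb]
    exact star_mul_self_nonneg (b : B)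
  have hnorm' : ‖(e : B)‖ ≤ 1 := hnorm
  have hmem := CStarAlgebra.mem_Icc_iff_norm_le_one.2 ⟨hpos', hnorm'⟩
  refine ⟨e, e.2, (IsSelfAdjoint.of_nonneg hpos').star_eq, ?_, ?_⟩
  · exact (CStarAlgebra.mem_Icc_iff_norm_le_one.1
      (Set.sub_mem_Icc_zero_iff_right.2 hmem)).2
  · rw [dist_comm, dist_eq_norm] at he
    exact he

/-- The C⋆-identity in the quotient by a closed self-adjoint two-sided ideal, on the level of
representatives. -/
theorem Ideal.norm_mk_mul_self_le {B : Type u} [CStarAlgebra B] (I : Ideal B) [I.IsTwoSided]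
    (hI : IsClosed (I : Set B)) (hstar : ∀ x ∈ I, star x ∈ I) (x : B) :
    ‖(Submodule.Quotient.mk x : B ⧸ I)‖ * ‖(Submodule.Quotient.mk x : B ⧸ I)‖ ≤
      ‖(Submodule.Quotient.mk (star x * x) : B ⧸ I)‖ := by
  refine le_of_forall_pos_le_add fun ε hε => ?_
  obtain ⟨m, hm, hmn⟩ := Submodule.Quotient.norm_mk_lt
    (Submodule.Quotient.mk (star x * x) : B ⧸ I) (half_pos hε)
  have hy : star x * x - m ∈ I := (Submodule.Quotient.eq I).1 hm.symm
  obtain ⟨e, heI, hes, he1, hey⟩ := I.exists_norm_sub_mul_lt hI hstar hy (half_pos hε)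
  -- `x * (1 - e)` represents the class of `x`, and the C⋆-identity for it holds in `B`. The factor
  -- `1 - e` nearly kills `x* x - m ∈ I`, leaving the almost minimal representative `m`.
  have h1 : ‖(Submodule.Quotient.mk x : B ⧸ I)‖ ≤ ‖x * (1 - e)‖ := by
    have : (Submodule.Quotient.mk x : B ⧸ I) = Submodule.Quotient.mk (x * (1 - e)) := by
      rw [Submodule.Quotient.eq, mul_sub, mul_one, sub_sub_cancel]
      exact I.mul_mem_left _ heI
    rw [this]
    exact Submodule.Quotient.norm_mk_le I _
  calc _ ≤ ‖x * (1 - e)‖ * ‖x * (1 - e)‖ := by gcongr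
    _ = ‖(1 - e) * (star x * x * (1 - e))‖ := by
        rw [← CStarRing.norm_star_mul_self, star_mul, star_sub, star_one, hes]
        simp only [mul_assoc]
    _ ≤ ‖1 - e‖ * ‖star x * x * (1 - e)‖ := norm_mul_le _ _
    _ ≤ 1 * ‖star x * x * (1 - e)‖ := by gcongr
    _ = ‖m * (1 - e) + ((star x * x - m) - (star x * x - m) * e)‖ := by
        rw [one_mul]; congr 1; noncomm_ring
    _ ≤ ‖m * (1 - e)‖ + ‖(star x * x - m) - (star x * x - m) * e‖ := norm_add_le _ _
    _ ≤ ‖m‖ * ‖1 - e‖ + ‖(star x * x - m) - (star x * x - m) * e‖ := by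
        gcongr; exact norm_mul_le _ _
    _ ≤ ‖m‖ * 1 + ε / 2 := by gcongr
    _ ≤ _ := by linarith

namespace ToeplitzCrossedProduct

variable {A : Type u} [CStarAlgebra A] {S : Type v} [CommMonoid S]
  {α : S → (A →⋆ₙₐ[ℂ] A)} {L : S → A → A} (T : ToeplitzCrossedProduct α L)

/-- The quotient norm makes the crossed product a normed ring. -/
noncomputable abbrev crossedProductNormedRing : NormedRing T.CrossedProduct :=
  { Submodule.Quotient.normedAddCommGroup T.redundancyIdeal,
    Ideal.Quotient.ring T.redundancyIdeal with
    norm_mul_le := fun x y => by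
      refine le_of_forall_pos_le_add fun ε hε => ?_
      have hcont : Filter.Tendsto (fun δ : ℝ => (‖x‖ + δ) * (‖y‖ + δ)) (nhdsWithin 0 (Set.Ioi 0))
          (nhds (‖x‖ * ‖y‖)) := by
        have : Continuous (fun δ : ℝ => (‖x‖ + δ) * (‖y‖ + δ)) := by fun_prop
        simpa using (this.tendsto 0).mono_left nhdsWithin_le_nhds
      obtain ⟨δ, hδ, hδ0⟩ := ((hcont.eventually_lt_const (lt_add_of_pos_right _ hε)).and
        self_mem_nhdsWithin).exists
      obtain ⟨a, rfl, ha⟩ := Submodule.Quotient.norm_mk_lt x hδ0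
      obtain ⟨b, rfl, hb⟩ := Submodule.Quotient.norm_mk_lt y hδ0
      calc _ ≤ ‖a * b‖ := Submodule.Quotient.norm_mk_le T.redundancyIdeal (a * b)
        _ ≤ ‖a‖ * ‖b‖ := norm_mul_le _ _
        _ ≤ _ := by gcongr
        _ ≤ _ := hδ.le }

attribute [local instance] crossedProductNormedRing

/-- The quotient norm makes the crossed product a normed algebra. -/
noncomputable abbrev crossedProductNormedAlgebra : NormedAlgebra ℂ T.CrossedProduct :=
  { Ideal.Quotient.algebra ℂ with
    norm_smul_le := fun c x =>
      (Submodule.Quotient.normedSpace T.redundancyIdeal ℂ).norm_smul_le c x }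

attribute [local instance] crossedProductNormedAlgebra

/-- The crossed product is a C⋆-algebra. -/
noncomputable abbrev crossedProductCStarAlgebra : CStarAlgebra T.CrossedProduct where
  toStarRing := T.crossedProductStarRing
  toCompleteSpace := Submodule.Quotient.completeSpace T.redundancyIdeal
  norm_mul_self_le := by
    rintro ⟨x⟩
    exact T.redundancyIdeal.norm_mk_mul_self_le T.redundancyIdeal_isClosed
      (fun _ => T.star_mem_redundancyIdeal) x
  star_smul := by
    rintro c ⟨x⟩
    exact congrArg (Ideal.Quotient.mk T.redundancyIdeal) (star_smul c x)

end ToeplitzCrossedProduct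

end Quotient

/-! ### Noncommutative polynomials and maps defined on generators -/

section Words

variable {A : Type u} [CStarAlgebra A] {S : Type v} [CommMonoid S]
  {D : Type*} [CStarAlgebra D] {E : Type*} [CStarAlgebra E]

/-- Evaluation of noncommutative polynomials in the elements of `A`, the elements of `S` and their
formal adjoints. -/
noncomputable def evalWord (iA : A →⋆ₐ[ℂ] D) (iS : S →* D) :
    FreeAlgebra ℂ (A ⊕ S ⊕ S) →ₐ[ℂ] D :=
  FreeAlgebra.lift ℂ (Sum.elim iA (Sum.elim iS fun s => star (iS s)))

@[simp]
theorem evalWord_inl (iA : A →⋆ₐ[ℂ] D) (iS : S →* D) (a : A) :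
    evalWord iA iS (FreeAlgebra.ι ℂ (.inl a)) = iA a := by
  simp [evalWord]

@[simp]
theorem evalWord_inr_inl (iA : A →⋆ₐ[ℂ] D) (iS : S →* D) (s : S) :
    evalWord iA iS (FreeAlgebra.ι ℂ (.inr (.inl s))) = iS s := by
  simp [evalWord]

@[simp]
theorem evalWord_inr_inr (iA : A →⋆ₐ[ℂ] D) (iS : S →* D) (s : S) :
    evalWord iA iS (FreeAlgebra.ι ℂ (.inr (.inr s))) = star (iS s) := by
  simp [evalWord]

/-- A single formal adjoint `y` must serve both evaluations: this is what makes the map extended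
from polynomials preserve the star. -/
theorem exists_evalWord_eq_star (iA : A →⋆ₐ[ℂ] D) (iS : S →* D) (pA : A →⋆ₐ[ℂ] E) (pS : S →* E)
    (x : FreeAlgebra ℂ (A ⊕ S ⊕ S)) :
    ∃ y, evalWord iA iS y = star (evalWord iA iS x) ∧
      evalWord pA pS y = star (evalWord pA pS x) := by
  induction x with
  | grade0 r =>
    exact ⟨algebraMap ℂ _ (star r), by simp only [AlgHom.commutes, algebraMap_star_comm, and_self]⟩
  | grade1 g =>
    rcases g with a | s | s
    · exact ⟨FreeAlgebra.ι ℂ (.inl (star a)), by simp only [evalWord_inl, map_star, and_self]⟩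
    · exact ⟨FreeAlgebra.ι ℂ (.inr (.inr s)), by
        simp only [evalWord_inr_inl, evalWord_inr_inr, and_self]⟩
    · exact ⟨FreeAlgebra.ι ℂ (.inr (.inl s)), by
        simp only [evalWord_inr_inl, evalWord_inr_inr, star_star, and_self]⟩
  | mul x y hx hy =>
    obtain ⟨x', hx₁, hx₂⟩ := hx
    obtain ⟨y', hy₁, hy₂⟩ := hy
    exact ⟨y' * x', by simp only [map_mul, star_mul, hx₁, hx₂, hy₁, hy₂, and_self]⟩
  | add x y hx hy =>
    obtain ⟨x', hx₁, hx₂⟩ := hx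
    obtain ⟨y', hy₁, hy₂⟩ := hy
    exact ⟨x' + y', by simp only [map_add, star_add, hx₁, hx₂, hy₁, hy₂, and_self]⟩

theorem StarAlgHom.map_evalWord (σ : D →⋆ₐ[ℂ] E) {iA : A →⋆ₐ[ℂ] D} {iS : S →* D}
    {pA : A →⋆ₐ[ℂ] E} {pS : S →* E} (hA : ∀ a, σ (iA a) = pA a) (hS : ∀ s, σ (iS s) = pS s)
    (x : FreeAlgebra ℂ (A ⊕ S ⊕ S)) : σ (evalWord iA iS x) = evalWord pA pS x := by
  suffices h : σ.toAlgHom.comp (evalWord iA iS) = evalWord pA pS from DFunLike.congr_fun h x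
  refine FreeAlgebra.hom_ext (funext ?_)
  rintro (a | s | s)
  · simpa using hA a
  · simpa using hS s
  · have := congrArg star (hS s)
    rw [← map_star] at this
    simpa using this

/-- `D` is generated as a C⋆-algebra by the products `iA a * iS s`. -/
def GeneratedBy (iA : A →⋆ₐ[ℂ] D) (iS : S →* D) : Prop :=
  (StarAlgebra.adjoin ℂ {x : D | ∃ (a : A) (s : S), x = iA a * iS s}).topologicalClosure = ⊤

/-- Formal adjoints make the range a star subalgebra, and it contains the generators. -/
theorem GeneratedBy.denseRange {iA : A →⋆ₐ[ℂ] D} {iS : S →* D} (h : GeneratedBy iA iS) :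
    DenseRange (evalWord iA iS) := by
  let R : StarSubalgebra ℂ D :=
    { (evalWord iA iS).range with
      star_mem' := by
        rintro _ ⟨x, rfl⟩
        obtain ⟨y, hy, -⟩ := exists_evalWord_eq_star iA iS iA iS x
        exact ⟨y, hy⟩ }
  have hR : StarAlgebra.adjoin ℂ {x : D | ∃ (a : A) (s : S), x = iA a * iS s} ≤ R := by
    refine StarAlgebra.adjoin_le ?_
    rintro _ ⟨a, s, rfl⟩
    exact ⟨FreeAlgebra.ι ℂ (.inl a) * FreeAlgebra.ι ℂ (.inr (.inl s)), by simp⟩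
  intro x
  have hx : x ∈ (StarAlgebra.adjoin ℂ
      {x : D | ∃ (a : A) (s : S), x = iA a * iS s}).topologicalClosure := by
    rw [show _ = _ from h]; trivial
  rw [← SetLike.mem_coe, StarSubalgebra.topologicalClosure_coe] at hx
  exact closure_mono hR hx

/-- A norm estimate on polynomials gives a `⋆`-homomorphism. -/
theorem GeneratedBy.exists_starAlgHom {iA : A →⋆ₐ[ℂ] D} {iS : S →* D} (h : GeneratedBy iA iS)
    (pA : A →⋆ₐ[ℂ] E) (pS : S →* E) (hle : ∀ x, ‖evalWord pA pS x‖ ≤ ‖evalWord iA iS x‖) :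
    ∃ ρ : D →⋆ₐ[ℂ] E, (∀ a, ρ (iA a) = pA a) ∧ ∀ s, ρ (iS s) = pS s := by
  let e : FreeAlgebra ℂ (A ⊕ S ⊕ S) →ₗ[ℂ] D := (evalWord iA iS).toLinearMap
  let f : FreeAlgebra ℂ (A ⊕ S ⊕ S) →ₗ[ℂ] E := (evalWord pA pS).toLinearMap
  have hd : DenseRange e := h.denseRange
  let r : D →L[ℂ] E := f.extendOfNorm e
  have hr : ∀ x, r (evalWord iA iS x) = evalWord pA pS x :=
    LinearMap.extendOfNorm_eq (f := f) (e := e) hd ⟨1, fun x => by rw [one_mul]; exact hle x⟩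
  have hmul : ∀ x y, r (x * y) = r x * r y := fun x y =>
    hd.induction_on₂ (p := fun x y => r (x * y) = r x * r y)
      (isClosed_eq (by fun_prop) (by fun_prop))
      (fun x y => by
        change r (evalWord iA iS x * evalWord iA iS y) =
          r (evalWord iA iS x) * r (evalWord iA iS y)
        rw [← map_mul, hr, hr, hr, map_mul]) x y
  have hstar : ∀ x, r (star x) = star (r x) := fun x =>
    hd.induction_on (p := fun x => r (star x) = star (r x)) x
      (isClosed_eq (by fun_prop) (by fun_prop))
      (fun x => by
        obtain ⟨y, hy₁, hy₂⟩ := exists_evalWord_eq_star iA iS pA pS x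
        change r (star (evalWord iA iS x)) = star (r (evalWord iA iS x))
        rw [← hy₁, hr, hr, hy₂])
  have hone : r 1 = 1 := by
    rw [← map_one (evalWord iA iS), hr, map_one]
  refine ⟨{ AlgHom.ofLinearMap r.toLinearMap hone hmul with map_star' := hstar }, fun a => ?_,
    fun s => ?_⟩
  · have := hr (FreeAlgebra.ι ℂ (.inl a))
    rwa [evalWord_inl, evalWord_inl] at this
  · have := hr (FreeAlgebra.ι ℂ (.inr (.inl s)))
    rwa [evalWord_inr_inl, evalWord_inr_inl] at this

/-- `⋆`-homomorphisms of C⋆-algebras are continuous. -/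
theorem StarAlgHom.continuous_of_cstarAlgebra (φ : D →⋆ₐ[ℂ] E) : Continuous φ :=
  AddMonoidHomClass.continuous_of_bound φ 1 fun x => by
    rw [one_mul]; exact NonUnitalStarAlgHom.norm_apply_le φ x

/-- `⋆`-homomorphisms are determined by their values on generators. -/
theorem GeneratedBy.starAlgHom_ext {iA : A →⋆ₐ[ℂ] D} {iS : S →* D} (h : GeneratedBy iA iS)
    {σ τ : D →⋆ₐ[ℂ] E} (hA : ∀ a, σ (iA a) = τ (iA a)) (hS : ∀ s, σ (iS s) = τ (iS s)) :
    σ = τ := by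
  refine DFunLike.coe_injective 
    (h.denseRange.equalizer σ.continuous_of_cstarAlgebra τ.continuous_of_cstarAlgebra
      (funext fun x => ?_))
  have h₁ := σ.map_evalWord (pA := τ.comp iA) (pS := (τ : D →* E).comp iS) hA hS x
  have h₂ := τ.map_evalWord (iA := iA) (iS := iS) (pA := τ.comp iA) (pS := (τ : D →* E).comp iS)
    (fun _ => rfl) (fun _ => rfl) x
  exact h₁.trans h₂.symm

end Words

/-! ### Passing to the generated C⋆-subalgebra -/

section GeneratedAlgebra

variable {A : Type u} [CStarAlgebra A] {S : Type v} [CommMonoid S]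
  {D : Type w} [CStarAlgebra D] (iA : A →⋆ₐ[ℂ] D) (iS : S →* D)

/-- The C⋆-subalgebra generated by the products `iA a * iS s`. -/
def generatedAlgebra : StarSubalgebra ℂ D :=
  (StarAlgebra.adjoin ℂ {x : D | ∃ (a : A) (s : S), x = iA a * iS s}).topologicalClosure

instance generatedAlgebra_isClosed : IsClosed (generatedAlgebra iA iS : Set D) :=
  StarSubalgebra.isClosed_topologicalClosure _

theorem mul_mem_generatedAlgebra (a : A) (s : S) : iA a * iS s ∈ generatedAlgebra iA iS :=
  StarSubalgebra.le_topologicalClosure _ (StarAlgebra.subset_adjoin ℂ _ ⟨a, s, rfl⟩)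

/-- The corestriction of `iA` to the generated algebra. -/
noncomputable def corestrictA : A →⋆ₐ[ℂ] generatedAlgebra iA iS :=
  iA.codRestrict _ fun a => by simpa using mul_mem_generatedAlgebra iA iS a 1

/-- The corestriction of `iS` to the generated algebra. -/
noncomputable def corestrictS : S →* generatedAlgebra iA iS :=
  iS.codRestrict (generatedAlgebra iA iS) fun s => by
    simpa using mul_mem_generatedAlgebra iA iS 1 s

/-- Closure in a subspace is tested on images under the inclusion, and the inclusion carries the
inner adjoin onto the one in `D`, whose closure is the subalgebra by definition. -/
theorem generatedBy_corestrict : GeneratedBy (D := generatedAlgebra iA iS)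
    (corestrictA iA iS) (corestrictS iA iS) := by
  rw [GeneratedBy, eq_top_iff]
  intro x _
  rw [← SetLike.mem_coe, StarSubalgebra.topologicalClosure_coe, closure_subtype]
  have himg : ((↑) : generatedAlgebra iA iS → D) ''
      (StarAlgebra.adjoin ℂ {x | ∃ (a : A) (s : S), x = corestrictA iA iS a * corestrictS iA iS s} :
        StarSubalgebra ℂ (generatedAlgebra iA iS)) =
      (StarAlgebra.adjoin ℂ {x | ∃ (a : A) (s : S), x = iA a * iS s} : StarSubalgebra ℂ D) := by
    have h := StarAlgHom.map_adjoin (generatedAlgebra iA iS).subtype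
      {x | ∃ (a : A) (s : S), x = corestrictA iA iS a * corestrictS iA iS s}
    have h' := congrArg (fun K : StarSubalgebra ℂ D => (K : Set D)) h
    rw [StarSubalgebra.coe_map] at h'
    refine h'.trans ?_
    congr 2
    ext y
    constructor
    · rintro ⟨_, ⟨a, s, rfl⟩, rfl⟩
      exact ⟨a, s, rfl⟩
    · rintro ⟨a, s, rfl⟩
      exact ⟨_, ⟨a, s, rfl⟩, rfl⟩
  rw [himg]
  exact x.2

theorem norm_evalWord_corestrict (x : FreeAlgebra ℂ (A ⊕ S ⊕ S)) :
    ‖evalWord (D := generatedAlgebra iA iS) (corestrictA iA iS) (corestrictS iA iS) x‖ =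
      ‖evalWord iA iS x‖ := by
  rw [← (generatedAlgebra iA iS).subtype.map_evalWord (iA := corestrictA iA iS)
    (iS := corestrictS iA iS) (pA := iA) (pS := iS) (fun _ => rfl) (fun _ => rfl) x]
  rfl

end GeneratedAlgebra

/-! ### Existence of Toeplitz crossed products -/

section Existence

open scoped ENNReal

noncomputable instance lp.instCStarAlgebraInfty {ι : Type*} {B : ι → Type*}
    [∀ i, CStarAlgebra (B i)] [∀ i, Nontrivial (B i)] : CStarAlgebra (lp B ∞) where

/-- A family of `⋆`-homomorphisms gives one into the bounded product. -/
noncomputable def StarAlgHom.toLp {ι : Type*} {B : ι → Type*} [∀ i, CStarAlgebra (B i)]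
    [∀ i, Nontrivial (B i)] {A : Type*} [CStarAlgebra A] (φ : ∀ i, A →⋆ₐ[ℂ] B i) :
    A →⋆ₐ[ℂ] lp B ∞ where
  toFun a := ⟨fun i => φ i a, memℓp_infty ⟨‖a‖, by
    rintro _ ⟨i, rfl⟩
    exact NonUnitalStarAlgHom.norm_apply_le (φ i) a⟩⟩
  map_one' := lp.ext (funext fun i => map_one (φ i))
  map_mul' a b := lp.ext (funext fun i => map_mul (φ i) a b)
  map_zero' := lp.ext (funext fun i => map_zero (φ i))
  map_add' a b := lp.ext (funext fun i => map_add (φ i) a b)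
  commutes' r := lp.ext (funext fun i => AlgHomClass.commutes (φ i) r)
  map_star' a := lp.ext (funext fun i => map_star (φ i) a)

/-- A uniformly bounded family of monoid homomorphisms gives one into the bounded product. -/
noncomputable def MonoidHom.toLp {ι : Type*} {B : ι → Type*} [∀ i, CStarAlgebra (B i)]
    [∀ i, Nontrivial (B i)] {S : Type*} [Monoid S] (V : ∀ i, S →* B i) (C : S → ℝ)
    (hV : ∀ i s, ‖V i s‖ ≤ C s) : S →* lp B ∞ where
  toFun s := ⟨fun i => V i s, memℓp_infty ⟨C s, by
    rintro _ ⟨i, rfl⟩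
    exact hV i s⟩⟩
  map_one' := lp.ext (funext fun i => map_one (V i))
  map_mul' a b := lp.ext (funext fun i => map_mul (V i) a b)

/-- Coordinate projections of the bounded product. -/
noncomputable def lp.evalStarAlgHom {ι : Type*} {B : ι → Type*} [∀ i, CStarAlgebra (B i)]
    [∀ i, Nontrivial (B i)] (i : ι) : lp B ∞ →⋆ₐ[ℂ] B i where
  toFun x := x i
  map_one' := rfl
  map_mul' _ _ := rfl
  map_zero' := rfl
  map_add' _ _ := rfl
  commutes' _ := rfl
  map_star' _ := rfl

variable {A : Type u} [CStarAlgebra A] {S : Type v} [CommMonoid S]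

/-- A Toeplitz covariant representation together with the nonzero Hilbert space it acts on. -/
structure CovariantRep (α : S → (A →⋆ₙₐ[ℂ] A)) (L : S → A → A) where
  /-- the Hilbert space -/
  H : Type (max u v)
  [normed : NormedAddCommGroup H]
  [inner : InnerProductSpace ℂ H]
  [complete : CompleteSpace H]
  [nontrivial : Nontrivial H]
  /-- the representation of `A` -/
  π : A →⋆ₐ[ℂ] (H →L[ℂ] H)
  /-- the representation of `S` -/
  V : S →* (H →L[ℂ] H)
  covariant : IsToeplitzCovariant α L π V

namespace CovariantRep

attribute [instance] CovariantRep.normed CovariantRep.inner CovariantRep.complete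
  CovariantRep.nontrivial

variable {α : S → (A →⋆ₙₐ[ℂ] A)} {L : S → A → A}

/-- Follows from `V* V = π (L s 1)`. The bound does not depend on the representation, so the family
`V s` defines an element of the bounded product. -/
theorem norm_V_le (R : CovariantRep α L) (s : S) : ‖R.V s‖ ≤ √‖L s 1‖ := by
  refine Real.le_sqrt_of_sq_le ?_
  have h := R.covariant.tc2 s 1
  rw [map_one, mul_one] at h
  rw [sq, ← CStarRing.norm_star_mul_self, h]
  exact NonUnitalStarAlgHom.norm_apply_le R.π _

/-- The seminorm on polynomials defined by a representation. -/
noncomputable def wordNorm (R : CovariantRep α L) (x : FreeAlgebra ℂ (A ⊕ S ⊕ S)) : ℝ :=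
  ‖evalWord R.π R.V x‖

variable (α L)

/-- The set of all seminorms defined by representations. -/
abbrev WordNorms : Type (max u v) := Set.range (wordNorm (α := α) (L := L))

/-- A representation which defines the given seminorm. -/
noncomputable def ofWordNorm (i : WordNorms α L) : CovariantRep α L := i.2.choose

variable {α L}

theorem wordNorm_ofWordNorm (i : WordNorms α L) : (ofWordNorm α L i).wordNorm = i.1 :=
  i.2.choose_spec

variable (α L)

/-- The bounded product of the algebras of all operators, over one representation for each
seminorm. -/
abbrev Ambient : Type (max u v) :=
  lp (fun i : WordNorms α L => (ofWordNorm α L i).H →L[ℂ] (ofWordNorm α L i).H) ∞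

/-- The universal representation of `A`. -/
noncomputable def univA : A →⋆ₐ[ℂ] Ambient α L := StarAlgHom.toLp fun i => (ofWordNorm α L i).π

/-- The universal representation of `S`. -/
noncomputable def univS : S →* Ambient α L :=
  MonoidHom.toLp (fun i => (ofWordNorm α L i).V) (fun s => √‖L s 1‖)
    fun i s => (ofWordNorm α L i).norm_V_le s

theorem univS_mul_univA (s : S) (a : A) :
    univS α L s * univA α L a = univA α L (α s a) * univS α L s :=
  lp.ext (funext fun i => (ofWordNorm α L i).covariant.tc1 s a)

theorem star_univS_mul_univA_mul (s : S) (a : A) :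
    star (univS α L s) * univA α L a * univS α L s = univA α L (L s a) :=
  lp.ext (funext fun i => (ofWordNorm α L i).covariant.tc2 s a)

/-- The product need not contain `R` itself, but it contains a representation with the same
seminorm, and coordinate projections are contractive. -/
theorem norm_evalWord_le (R : CovariantRep α L) (x : FreeAlgebra ℂ (A ⊕ S ⊕ S)) :
    ‖evalWord R.π R.V x‖ ≤ ‖evalWord (univA α L) (univS α L) x‖ := by
  let i : WordNorms α L := ⟨R.wordNorm, R, rfl⟩
  have h₁ : ‖evalWord (ofWordNorm α L i).π (ofWordNorm α L i).V x‖ = ‖evalWord R.π R.V x‖ :=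
    congrFun (wordNorm_ofWordNorm i) x
  let τ := lp.evalStarAlgHom
    (B := fun i : WordNorms α L => (ofWordNorm α L i).H →L[ℂ] (ofWordNorm α L i).H) i
  have h₂ : τ (evalWord (univA α L) (univS α L) x) =
      evalWord (ofWordNorm α L i).π (ofWordNorm α L i).V x :=
    τ.map_evalWord (fun _ => rfl) (fun _ => rfl) x
  rw [← h₁, ← h₂]
  exact NonUnitalStarAlgHom.norm_apply_le τ _

end CovariantRep

/-- A covariant pair in a C⋆-algebra whose norms dominate those of all covariant representations
generates a Toeplitz crossed product. -/
theorem ToeplitzCrossedProduct.nonempty_of_norm_le {α : S → (A →⋆ₙₐ[ℂ] A)} {L : S → A → A}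
    {D : Type (max u v)} [CStarAlgebra D] (iA : A →⋆ₐ[ℂ] D) (iS : S →* D)
    (h₁ : ∀ s a, iS s * iA a = iA (α s a) * iS s)
    (h₂ : ∀ s a, star (iS s) * iA a * iS s = iA (L s a))
    (hle : ∀ (R : CovariantRep α L) x, ‖evalWord R.π R.V x‖ ≤ ‖evalWord iA iS x‖) :
    Nonempty (ToeplitzCrossedProduct α L) := by
  refine ⟨{ Carrier := generatedAlgebra iA iS
            iA := corestrictA iA iS
            iS := corestrictS iA iS
            generated := generatedBy_corestrict iA iS
            covariant := ?_
            universal := ?_ }⟩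
  · intro H _ _ _ σ
    constructor
    · intro s a
      have h : corestrictS iA iS s * corestrictA iA iS a =
          corestrictA iA iS (α s a) * corestrictS iA iS s := Subtype.ext (h₁ s a)
      have := congrArg σ h
      rwa [map_mul, map_mul] at this
    · intro s a
      have h : star (corestrictS iA iS s) * corestrictA iA iS a * corestrictS iA iS s =
          corestrictA iA iS (L s a) := Subtype.ext (h₂ s a)
      have := congrArg σ h
      rwa [map_mul, map_mul, map_star] at this
  · intro H _ _ _ π V hcov
    refine (generatedBy_corestrict iA iS).exists_starAlgHom π V fun x => ?_
    rw [norm_evalWord_corestrict]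
    -- `CovariantRep` admits only nonzero spaces; on the zero space every operator vanishes.
    rcases subsingleton_or_nontrivial H with hH | hH
    · rw [Subsingleton.elim (evalWord π V x) 0, norm_zero]
      exact norm_nonneg _
    · exact hle ⟨H, π, V, hcov⟩ x

/-- Toeplitz crossed products exist. -/
theorem ToeplitzCrossedProduct.nonempty (α : S → (A →⋆ₙₐ[ℂ] A)) (L : S → A → A) :
    Nonempty (ToeplitzCrossedProduct α L) :=
  nonempty_of_norm_le (CovariantRep.univA α L) (CovariantRep.univS α L)
    (CovariantRep.univS_mul_univA α L) (CovariantRep.star_univS_mul_univA_mul α L)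
    (CovariantRep.norm_evalWord_le α L)

end Existence

/-! ### Covariance and universality in C⋆-algebras -/

namespace ToeplitzCrossedProduct

variable {A : Type u} [CStarAlgebra A] {S : Type v} [CommMonoid S]
  {α : S → (A →⋆ₙₐ[ℂ] A)} {L : S → A → A} (T : ToeplitzCrossedProduct α L)

theorem iS_mul_iA (s : S) (a : A) : T.iS s * T.iA a = T.iA (α s a) * T.iS s :=
  CStarAlgebra.eq_of_forall_representation fun H _ _ _ σ => by
    rw [map_mul, map_mul]
    exact (T.covariant H σ).tc1 s a

theorem star_iS_mul_iA_mul (s : S) (a : A) :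
    star (T.iS s) * T.iA a * T.iS s = T.iA (L s a) :=
  CStarAlgebra.eq_of_forall_representation fun H _ _ _ σ => by
    rw [map_mul, map_mul, map_star]
    exact (T.covariant H σ).tc2 s a

/-- The universal property of a Toeplitz crossed product, for covariant pairs in a C⋆-algebra. -/
theorem exists_lift {E : Type (max u v)} [CStarAlgebra E] (pA : A →⋆ₐ[ℂ] E) (pS : S →* E)
    (h₁ : ∀ s a, pS s * pA a = pA (α s a) * pS s)
    (h₂ : ∀ s a, star (pS s) * pA a * pS s = pA (L s a)) :
    ∃ ρ : T.Carrier →⋆ₐ[ℂ] E, (∀ a, ρ (T.iA a) = pA a) ∧ ∀ s, ρ (T.iS s) = pS s := by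
  refine GeneratedBy.exists_starAlgHom T.generated pA pS fun x => ?_
  -- Norms in `E` are tested by representations `σ`. Each `σ` composed with the pair is covariant,
  -- hence factors through a contractive representation of `T.Carrier`.
  refine CStarAlgebra.norm_le_of_forall_representation (norm_nonneg _) fun H _ _ _ σ => ?_
  have hcov : IsToeplitzCovariant α L (σ.comp pA) ((σ : E →* (H →L[ℂ] H)).comp pS) := by
    constructor
    · intro s a
      have := congrArg σ (h₁ s a)
      rwa [map_mul, map_mul] at this
    · intro s a
      have := congrArg σ (h₂ s a)
      rwa [map_mul, map_mul, map_star] at this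
  obtain ⟨ρ, hρA, hρS⟩ := T.universal H _ _ hcov
  have e₁ := ρ.map_evalWord hρA hρS x
  have e₂ := σ.map_evalWord (iA := pA) (iS := pS) (pA := σ.comp pA)
    (pS := (σ : E →* (H →L[ℂ] H)).comp pS) (fun _ => rfl) (fun _ => rfl) x
  rw [e₂, ← e₁]
  exact NonUnitalStarAlgHom.norm_apply_le ρ _

end ToeplitzCrossedProduct

/-- The adjoint of a homomorphism of an abelian monoid into a `⋆`-ring. -/
def MonoidHom.adjoint {S : Type*} [CommMonoid S] {E : Type*} [Semiring E] [StarRing E]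
    (V : S →* E) : S →* E where
  toFun s := star (V s)
  map_one' := by simp
  map_mul' s t := by rw [mul_comm s t, map_mul, star_mul]

/-! ### Transfer operators and adjoint covariance relations -/

section Transfer

variable {A : Type u} [CStarAlgebra A] {φ ψ : A →⋆ₙₐ[ℂ] A}

theorem NonUnitalStarAlgHom.isTransferOperator_of_leftInverse (h : ∀ a, φ (ψ a) = a) :
    IsTransferOperator ψ φ where
  isLinear := ⟨map_add φ, map_smul φ⟩
  continuous := AddMonoidHomClass.continuous_of_bound φ 1 fun x => by
    rw [one_mul]; exact NonUnitalStarAlgHom.norm_apply_le φ x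
  positive a := ⟨φ a, by rw [map_mul, map_star]⟩
  transfer a x := by rw [map_mul, h]

theorem IsTransferOperator.map_apply (h : IsTransferOperator φ ψ) (a : A) :
    ψ (φ a) = a * ψ 1 := by
  rw [← h.transfer, mul_one]

/-- The adjoint of `map_apply` at `star a`. Together the two show that `ψ 1` is central. -/
theorem IsTransferOperator.map_apply' (h : IsTransferOperator φ ψ) (a : A) :
    ψ (φ a) = ψ 1 * a := by
  have := congrArg star (h.map_apply (star a))
  rwa [star_mul, star_star, ← map_star, ← map_star, ← map_star, star_one, star_star] at this

end Transfer

section Duality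

variable {A : Type u} [CStarAlgebra A] {E : Type*} [Semiring E] [StarRing E] [Algebra ℂ E]
  {φ ψ : A →⋆ₙₐ[ℂ] A} {π : A →⋆ₐ[ℂ] E} {V : E}

/-- `V` is an isometry, so `V* = V* V V*`, and `V V* = π (ψ 1)` commutes with `π a`; moving it to
the right leaves `V* π(a) V V*`. -/
theorem star_mul_map_of_mul_mul_star (hφ : φ 1 = 1) (hψ : IsTransferOperator φ ψ)
    (h₂ : ∀ a, star V * π a * V = π (φ a)) (h₃ : ∀ a, V * π a * star V = π (ψ a)) (a : A) :
    star V * π a = π (φ a) * star V := by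
  have hV : star V * V = 1 := by simpa [hφ] using h₂ 1
  have hVV : V * star V = π (ψ 1) := by simpa using h₃ 1
  have hcomm : V * star V * π a = π a * (V * star V) := by
    rw [hVV, ← map_mul, ← map_mul, ← hψ.map_apply, hψ.map_apply']
  calc star V * π a = star V * V * star V * π a := by rw [hV, one_mul]
    _ = star V * (V * star V * π a) := by simp only [mul_assoc]
    _ = star V * π a * V * star V := by rw [hcomm]; simp only [mul_assoc]
    _ = π (φ a) * star V := by rw [h₂]

theorem star_mul_map_of_mul_star_eq_one {W : E} (h₂ : ∀ a, star W * π a * W = π (ψ a))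
    (h₃ : W * star W = 1) (a : A) : star W * π a = π (ψ a) * star W := by
  rw [← h₂, mul_assoc _ W, h₃, mul_one]

theorem mul_map_mul_star_of_mul_star_eq_one {W : E} (h₁ : ∀ a, W * π a = π (φ a) * W)
    (h₃ : W * star W = 1) (a : A) : W * π a * star W = π (φ a) := by
  rw [h₁, mul_assoc, h₃, mul_one]

end Duality

theorem StarAlgHom.map_eq_map_mul_of_mem_closure_span {D E : Type*} [CStarAlgebra D]
    [CStarAlgebra E] (ρ : D →⋆ₐ[ℂ] E) {X : Set D} {q : E} (h : ∀ x ∈ X, ρ x = ρ x * q) {y : D}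
    (hy : y ∈ (Submodule.span ℂ X).topologicalClosure) : ρ y = ρ y * q := by
  have hc := ρ.continuous_of_cstarAlgebra
  have hcl : IsClosed {y : D | ρ y = ρ y * q} := isClosed_eq hc (by fun_prop)
  refine closure_minimal (fun z hz => ?_) hcl hy
  rw [Set.mem_ofPred_eq]
  induction hz using Submodule.span_induction with
  | mem z hz => exact h z hz
  | zero => simp
  | add x z _ _ hx hz => rw [map_add, add_mul, ← hx, ← hz]
  | smul c z _ hz => rw [map_smul, smul_mul_assoc, ← hz]

/-! ### Universal properties of the crossed products and their isomorphism -/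

namespace ToeplitzCrossedProduct

attribute [local instance] crossedProductCStarAlgebra

variable {A : Type u} [CStarAlgebra A] {S : Type v} [CommMonoid S]

section General

variable {α : S → (A →⋆ₙₐ[ℂ] A)} {L : S → A → A} (T : ToeplitzCrossedProduct α L)

/-- `jA` as a `⋆`-homomorphism. -/
noncomputable def jAHom : A →⋆ₐ[ℂ] T.CrossedProduct := T.quot.comp T.iA

/-- `jS` as a monoid homomorphism. -/
noncomputable def jSHom : S →* T.CrossedProduct :=
  (T.quot : T.Carrier →* T.CrossedProduct).comp T.iS

theorem jSHom_mul_jAHom (s : S) (a : A) :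
    T.jSHom s * T.jAHom a = T.jAHom (α s a) * T.jSHom s := by
  have := congrArg T.quot (T.iS_mul_iA s a)
  rwa [map_mul, map_mul] at this

theorem star_jSHom_mul_jAHom_mul (s : S) (a : A) :
    star (T.jSHom s) * T.jAHom a * T.jSHom s = T.jAHom (L s a) := by
  have := congrArg T.quot (T.star_iS_mul_iA_mul s a)
  rwa [map_mul, map_mul, map_star] at this

theorem quot_surjective : Function.Surjective T.quot := Ideal.Quotient.mk_surjective

theorem starAlgHom_ext {E : Type*} [CStarAlgebra E] {σ τ : T.CrossedProduct →⋆ₐ[ℂ] E}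
    (hA : ∀ a, σ (T.jA a) = τ (T.jA a)) (hS : ∀ s, σ (T.jS s) = τ (T.jS s)) : σ = τ := by
  have h : σ.comp T.quot = τ.comp T.quot := GeneratedBy.starAlgHom_ext T.generated hA hS
  refine StarAlgHom.ext fun x => ?_
  obtain ⟨y, rfl⟩ := T.quot_surjective x
  exact DFunLike.congr_fun h y

theorem quot_sub_eq_zero {s : S} {a k : T.Carrier} (ha : a ∈ T.idealPart s)
    (h : T.IsRedundancy s a k) : T.quot a = T.quot k := by
  rw [← sub_eq_zero, ← map_sub]
  refine Ideal.Quotient.eq_zero_iff_mem.2 ?_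
  simp only [redundancyIdeal, Submodule.mem_sInf]
  exact fun J hJ => hJ.2.2 ⟨s, a, k, ha, h, rfl⟩

/-- A `⋆`-homomorphism which vanishes on the differences of redundancies factors through the
crossed product. -/
theorem exists_factor {E : Type*} [CStarAlgebra E] (ρ : T.Carrier →⋆ₐ[ℂ] E)
    (h : ∀ x ∈ T.redundancyDiffs, ρ x = 0) :
    ∃ τ : T.CrossedProduct →⋆ₐ[ℂ] E, ∀ x, τ (T.quot x) = ρ x := by
  have hker : ∀ x ∈ T.redundancyIdeal, ρ x = 0 := by
    intro x hx
    simp only [redundancyIdeal, Submodule.mem_sInf] at hx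
    exact hx (RingHom.ker ρ) ⟨inferInstance,
      isClosed_eq ρ.continuous_of_cstarAlgebra continuous_const, fun y hy => h y hy⟩
  refine ⟨{ Ideal.Quotient.liftₐ T.redundancyIdeal ρ.toAlgHom hker with map_star' := ?_ },
    fun x => rfl⟩
  intro x
  obtain ⟨y, rfl⟩ := T.quot_surjective x
  exact map_star ρ y

/-- If the range projection of the image of `i_S(s)` is a right unit for the images of `a` and `k`,
then a redundancy `(a, k)` has `ρ a = ρ k`. -/
theorem IsRedundancy.map_eq {T : ToeplitzCrossedProduct α L} {E : Type*} [CStarAlgebra E]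
    (ρ : T.Carrier →⋆ₐ[ℂ] E) {s : S} {a k : T.Carrier} (h : T.IsRedundancy s a k)
    (ha : ρ a = ρ a * (ρ (T.iS s) * star (ρ (T.iS s))))
    (hk : ρ k = ρ k * (ρ (T.iS s) * star (ρ (T.iS s)))) : ρ a = ρ k := by
  have h1 := h.mul_eq 1
  rw [map_one, mul_one, mul_one] at h1
  rw [ha, hk, ← mul_assoc, ← mul_assoc, ← map_mul, ← map_mul, h1]

end General

section Dual

variable {β L : S →* (A →⋆ₙₐ[ℂ] A)}

/-- In the crossed product by `L`, the range projections of `S` belong to `A`. -/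
theorem jSHom_mul_star_jSHom (hL : ∀ s, IsTransferOperator (β s) (L s))
    (T : ToeplitzCrossedProduct L (fun s => β s)) (s : S) :
    T.jSHom s * star (T.jSHom s) = T.jAHom (L s 1) := by
  -- `V V* b V = V β(b) = L(β(b)) V = L(1) b V`.
  have hred : T.IsRedundancy s (T.iA (L s 1)) (T.iS s * star (T.iS s)) := by
    refine ⟨⟨_, rfl⟩, ?_, fun b => ?_⟩
    · exact Submodule.le_topologicalClosure _ (Submodule.subset_span ⟨1, 1, by simp⟩)
    · have h := T.star_iS_mul_iA_mul s b
      rw [mul_assoc (T.iS s * _), mul_assoc (T.iS s), ← mul_assoc (star _), h, T.iS_mul_iA,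
        (hL s).map_apply', map_mul]
  have hmem : T.iA (L s 1) ∈ T.idealPart s :=
    Submodule.le_topologicalClosure _ (Submodule.subset_span ⟨1, 1, 1, by simp⟩)
  have := T.quot_sub_eq_zero hmem hred
  rw [map_mul, map_star] at this
  exact this.symm

/-- The universal property of the crossed product by `L`. -/
theorem exists_lift_crossedProduct
    (hL : ∀ s, IsTransferOperator (β s) (L s))
    (T : ToeplitzCrossedProduct L (fun s => β s)) {E : Type (max u v)} [CStarAlgebra E]
    (pA : A →⋆ₐ[ℂ] E) (pS : S →* E)
    (h₁ : ∀ s a, pS s * pA a = pA (L s a) * pS s)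
    (h₂ : ∀ s a, star (pS s) * pA a * pS s = pA (β s a))
    (h₃ : ∀ s, pS s * star (pS s) = pA (L s 1)) :
    ∃ τ : T.CrossedProduct →⋆ₐ[ℂ] E, (∀ a, τ (T.jA a) = pA a) ∧ ∀ s, τ (T.jS s) = pS s := by
  obtain ⟨ρ, hA, hS⟩ := T.exists_lift pA pS h₁ h₂
  -- The adjoint of `L(1) V = V 1`, which is covariance at `1`.
  have hstar : ∀ s, star (pS s) * pA (L s 1) = star (pS s) := fun s => by
    rw [← star_star (pA (L s 1)), ← star_mul, ← map_star pA, ← map_star (L s), star_one, ← h₁,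
      map_one, mul_one]
  have hcentral : ∀ s a, a * L s 1 = L s 1 * a := fun s a => by
    rw [← (hL s).map_apply, (hL s).map_apply']
  obtain ⟨τ, hτ⟩ := T.exists_factor ρ (by
    rintro _ ⟨s, a, k, ha, h, rfl⟩
    rw [map_sub, sub_eq_zero]
    refine h.map_eq ρ ?_ ?_
    · rw [hS, h₃]
      -- On a generator `a L(b) c`, centrality moves `L(1)` past `c` to be absorbed by `L(b)`. This
      -- is where membership in the ideal generated by `L(A)` enters.
      refine ρ.map_eq_map_mul_of_mem_closure_span ?_ ha
      rintro _ ⟨a, b, c, rfl⟩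
      have hb : L s b * L s 1 = L s b := by rw [← map_mul, mul_one]
      rw [hA, ← map_mul pA, mul_assoc (a * _) c, hcentral, ← mul_assoc, mul_assoc a _ (L s 1), hb]
    · rw [hS, h₃]
      -- On a generator `a V V* b`, centrality moves `L(1)` past `b` to be absorbed by `V*`.
      refine ρ.map_eq_map_mul_of_mem_closure_span ?_ h.mem_compactPart
      rintro _ ⟨a, b, rfl⟩
      rw [map_mul, mul_assoc (ρ _), hA b, ← map_mul pA, hcentral, map_mul pA, ← mul_assoc, map_mul ρ,
        mul_assoc _ _ (pA (L s 1)), map_star, hS, hstar])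
  exact ⟨τ, fun a => (hτ _).trans (hA a), fun s => (hτ _).trans (hS s)⟩

/-- In the crossed product by `β`, the semigroup is represented by coisometries. -/
theorem jSHom_mul_star_jSHom_eq_one (hβ : ∀ s, β s 1 = 1) (hβL : ∀ s a, β s (L s a) = a)
    (T : ToeplitzCrossedProduct β (fun s => L s)) (s : S) :
    T.jSHom s * star (T.jSHom s) = 1 := by
  -- `W W* b W = W L(b) = β(L(b)) W = b W`. The pair is admissible because `1 = β s 1` lies in the
  -- ideal generated by the range of `β s`.
  have hred : T.IsRedundancy s (T.iA 1) (T.iS s * star (T.iS s)) := by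
    refine ⟨⟨_, rfl⟩, ?_, fun b => ?_⟩
    · exact Submodule.le_topologicalClosure _ (Submodule.subset_span ⟨1, 1, by simp⟩)
    · have h := T.star_iS_mul_iA_mul s b
      rw [mul_assoc (T.iS s * _), mul_assoc (T.iS s), ← mul_assoc (star _), h, T.iS_mul_iA, hβL,
        map_one, one_mul]
  have hmem : T.iA 1 ∈ T.idealPart s :=
    Submodule.le_topologicalClosure _ (Submodule.subset_span ⟨1, 1, 1, by simp [hβ]⟩)
  have := T.quot_sub_eq_zero hmem hred
  rw [map_mul, map_star, map_one, map_one] at this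
  exact this.symm

/-- The universal property of the crossed product by `β`. -/
theorem exists_lift_crossedProduct_of_mul_star_eq_one
    (T : ToeplitzCrossedProduct β (fun s => L s)) {E : Type (max u v)} [CStarAlgebra E]
    (pA : A →⋆ₐ[ℂ] E) (pS : S →* E)
    (h₁ : ∀ s a, pS s * pA a = pA (β s a) * pS s)
    (h₂ : ∀ s a, star (pS s) * pA a * pS s = pA (L s a))
    (h₃ : ∀ s, pS s * star (pS s) = 1) :
    ∃ τ : T.CrossedProduct →⋆ₐ[ℂ] E, (∀ a, τ (T.jA a) = pA a) ∧ ∀ s, τ (T.jS s) = pS s := by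
  obtain ⟨ρ, hA, hS⟩ := T.exists_lift pA pS h₁ h₂
  obtain ⟨τ, hτ⟩ := T.exists_factor ρ (by
    rintro _ ⟨s, a, k, -, h, rfl⟩
    rw [map_sub, sub_eq_zero]
    exact h.map_eq ρ (by rw [hS, h₃, mul_one]) (by rw [hS, h₃, mul_one]))
  exact ⟨τ, fun a => (hτ _).trans (hA a), fun s => (hτ _).trans (hS s)⟩

/-- The crossed products by `L` and by `β` are isomorphic. -/
theorem exists_starAlgEquiv (hβ : ∀ s, β s 1 = 1) (hL : ∀ s, IsTransferOperator (β s) (L s))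
    (hβL : ∀ s a, β s (L s a) = a) (T₁ : ToeplitzCrossedProduct L (fun s => β s))
    (T₂ : ToeplitzCrossedProduct β (fun s => L s)) :
    ∃ Φ : T₁.CrossedProduct ≃⋆ₐ[ℂ] T₂.CrossedProduct,
      (∀ a, Φ (T₁.jA a) = T₂.jA a) ∧ ∀ s, Φ (T₁.jS s) = star (T₂.jS s) := by
  have hm₁ : ∀ s a, T₁.jSHom s * T₁.jAHom a * star (T₁.jSHom s) = T₁.jAHom (L s a) :=
    fun s a => by
      rw [T₁.jSHom_mul_jAHom, mul_assoc, T₁.jSHom_mul_star_jSHom hL, ← map_mul, ← map_mul,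
        mul_one]
  have hi₁ : ∀ s, star (T₁.jSHom s) * T₁.jSHom s = 1 := fun s => by
    simpa [hβ] using T₁.star_jSHom_mul_jAHom_mul s 1
  have hco₂ := T₂.jSHom_mul_star_jSHom_eq_one hβ hβL
  obtain ⟨Φ, hΦA, hΦS⟩ := T₁.exists_lift_crossedProduct hL T₂.jAHom T₂.jSHom.adjoint
    (fun s a => star_mul_map_of_mul_star_eq_one (T₂.star_jSHom_mul_jAHom_mul s) (hco₂ s) a)
    (fun s a => by
      change star (star (T₂.jSHom s)) * T₂.jAHom a * star (T₂.jSHom s) = T₂.jAHom (β s a)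
      rw [star_star]
      exact mul_map_mul_star_of_mul_star_eq_one (T₂.jSHom_mul_jAHom s) (hco₂ s) a)
    (fun s => by
      change star (T₂.jSHom s) * star (star (T₂.jSHom s)) = T₂.jAHom (L s 1)
      rw [star_star]
      simpa using T₂.star_jSHom_mul_jAHom_mul s 1)
  obtain ⟨Ψ, hΨA, hΨS⟩ := T₂.exists_lift_crossedProduct_of_mul_star_eq_one T₁.jAHom
    T₁.jSHom.adjoint
    (fun s a => star_mul_map_of_mul_mul_star (hβ s) (hL s) (T₁.star_jSHom_mul_jAHom_mul s)
      (hm₁ s) a)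
    (fun s a => by
      change star (star (T₁.jSHom s)) * T₁.jAHom a * star (T₁.jSHom s) = T₁.jAHom (L s a)
      rw [star_star, hm₁])
    (fun s => by
      change star (T₁.jSHom s) * star (star (T₁.jSHom s)) = 1
      rw [star_star, hi₁])
  have hΦS' : ∀ s, Φ (T₁.jS s) = star (T₂.jS s) := hΦS
  have hΨS' : ∀ s, Ψ (T₂.jS s) = star (T₁.jS s) := hΨS
  have hΦA' : ∀ a, Φ (T₁.jA a) = T₂.jA a := hΦA
  have hΨA' : ∀ a, Ψ (T₂.jA a) = T₁.jA a := hΨA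
  have hΨΦ : Ψ.comp Φ = .id ℂ _ := T₁.starAlgHom_ext
    (fun a => by rw [StarAlgHom.comp_apply, hΦA', hΨA']; rfl)
    (fun s => by
      rw [StarAlgHom.comp_apply, hΦS', map_star, hΨS', star_star]; rfl)
  have hΦΨ : Φ.comp Ψ = .id ℂ _ := T₂.starAlgHom_ext
    (fun a => by rw [StarAlgHom.comp_apply, hΨA', hΦA']; rfl)
    (fun s => by
      rw [StarAlgHom.comp_apply, hΨS', map_star, hΦS', star_star]; rfl)
  exact ⟨StarAlgEquiv.ofStarAlgHom Φ Ψ hΨΦ hΦΨ, hΦA, hΦS⟩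

/-- A representation of both crossed products on the same Hilbert space. -/
theorem exists_lift_pair (hβ : ∀ s, β s 1 = 1) (hL : ∀ s, IsTransferOperator (β s) (L s))
    (T₁ : ToeplitzCrossedProduct L (fun s => β s)) (T₂ : ToeplitzCrossedProduct β (fun s => L s))
    {H : Type (max u v)} [NormedAddCommGroup H] [InnerProductSpace ℂ H] [CompleteSpace H]
    (π : A →⋆ₐ[ℂ] (H →L[ℂ] H)) (V : S →* (H →L[ℂ] H))
    (hcov : IsToeplitzCovariant L (fun s => β s) π V)
    (h₃ : ∀ s a, V s * π a * star (V s) = π (L s a)) :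
    ∃ (ρ₁ : T₁.CrossedProduct →⋆ₐ[ℂ] (H →L[ℂ] H)) (ρ₂ : T₂.CrossedProduct →⋆ₐ[ℂ] (H →L[ℂ] H)),
      (∀ a, ρ₁ (T₁.jA a) = π a) ∧ (∀ s, ρ₁ (T₁.jS s) = V s) ∧
      (∀ a, ρ₂ (T₂.jA a) = π a) ∧ ∀ s, ρ₂ (T₂.jS s) = star (V s) := by
  have hV : ∀ s, star (V s) * V s = 1 := fun s => by simpa [hβ] using hcov.tc2 s 1
  obtain ⟨ρ₁, h₁A, h₁S⟩ := T₁.exists_lift_crossedProduct hL π V hcov.tc1 hcov.tc2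
    (fun s => by simpa using h₃ s 1)
  obtain ⟨ρ₂, h₂A, h₂S⟩ := T₂.exists_lift_crossedProduct_of_mul_star_eq_one π V.adjoint
    (fun s a => star_mul_map_of_mul_mul_star (hβ s) (hL s) (hcov.tc2 s) (h₃ s) a)
    (fun s a => by
      change star (star (V s)) * π a * star (V s) = π (L s a)
      rw [star_star, h₃])
    (fun s => by
      change star (V s) * star (star (V s)) = 1
      rw [star_star, hV])
  exact ⟨ρ₁, ρ₂, h₁A, h₁S, h₂A, h₂S⟩

/-- The isomorphism of the crossed products is isometric and intertwines their representations. -/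
theorem exists_isometric_starAlgEquiv (hβ : ∀ s, β s 1 = 1)
    (hL : ∀ s, IsTransferOperator (β s) (L s)) (hβL : ∀ s a, β s (L s a) = a)
    (T₁ : ToeplitzCrossedProduct L (fun s => β s))
    (T₂ : ToeplitzCrossedProduct β (fun s => L s)) :
    ∃ Φ : T₁.CrossedProduct ≃⋆ₐ[ℂ] T₂.CrossedProduct,
      (∀ x, ‖Φ x‖ = ‖x‖) ∧
      (∀ a, Φ (T₁.jA a) = T₂.jA a) ∧
      (∀ s, Φ (T₁.jS s) = star (T₂.jS s)) ∧
      (∀ (H : Type (max u v)) [NormedAddCommGroup H] [InnerProductSpace ℂ H] [CompleteSpace H]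
        (π : A →⋆ₐ[ℂ] (H →L[ℂ] H)) (V : S →* (H →L[ℂ] H)),
        IsToeplitzCovariant L (fun s => β s) π V →
        (∀ s a, V s * π a * star (V s) = π (L s a)) →
        ∃ (ρ₁ : T₁.CrossedProduct →⋆ₐ[ℂ] (H →L[ℂ] H))
          (ρ₂ : T₂.CrossedProduct →⋆ₐ[ℂ] (H →L[ℂ] H)),
          (∀ a, ρ₁ (T₁.jA a) = π a) ∧ (∀ s, ρ₁ (T₁.jS s) = V s) ∧
          (∀ a, ρ₂ (T₂.jA a) = π a) ∧ (∀ s, ρ₂ (T₂.jS s) = star (V s)) ∧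
          ∀ x, ρ₂ (Φ x) = ρ₁ x) := by
  obtain ⟨Φ, hΦA, hΦS⟩ := T₁.exists_starAlgEquiv hβ hL hβL T₂
  refine ⟨Φ, NonUnitalStarAlgHom.norm_map Φ Φ.injective, hΦA, hΦS, ?_⟩
  intro H _ _ _ π V hcov h₃
  obtain ⟨ρ₁, ρ₂, h₁A, h₁S, h₂A, h₂S⟩ := T₁.exists_lift_pair hβ hL T₂ π V hcov h₃
  refine ⟨ρ₁, ρ₂, h₁A, h₁S, h₂A, h₂S, fun x => ?_⟩
  have h : ρ₂.comp (Φ : T₁.CrossedProduct →⋆ₐ[ℂ] T₂.CrossedProduct) = ρ₁ := T₁.starAlgHom_ext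
    (fun a => (congrArg ρ₂ (hΦA a)).trans ((h₂A a).trans (h₁A a).symm))
    (fun s => (congrArg ρ₂ (hΦS s)).trans (by rw [map_star, h₂S, star_star, h₁S]))
  exact DFunLike.congr_fun h x

end Dual

end ToeplitzCrossedProduct

/-! ### The bijection of representations and the main theorem -/

/-- Taking adjoints is a bijection between the two kinds of covariant representations. -/
theorem bijOn_adjointRep {A : Type u} [CStarAlgebra A] {S : Type v} [CommMonoid S]
    {β L : S →* (A →⋆ₙₐ[ℂ] A)} (hβ : ∀ s, β s 1 = 1) (hL : ∀ s, IsTransferOperator (β s) (L s))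
    (H : Type w) [NormedAddCommGroup H] [InnerProductSpace ℂ H] [CompleteSpace H] :
    Set.BijOn
      (fun P : (A →⋆ₐ[ℂ] (H →L[ℂ] H)) × (S →* (H →L[ℂ] H)) => (P.1, adjointRep P.2))
      {P | IsToeplitzCovariant L (fun s => β s) P.1 P.2 ∧
        ∀ s a, P.2 s * P.1 a * star (P.2 s) = P.1 (L s a)}
      {P | IsToeplitzCovariant β (fun s => L s) P.1 P.2 ∧
        ∀ s a, P.1 a = P.1 a * P.2 s * star (P.2 s)} := by
  refine ⟨?_, ?_, ?_⟩
  · rintro ⟨π, V⟩ ⟨hcov, h₃⟩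
    have hiso : ∀ s, star (V s) * V s = 1 := fun s => by simpa [hβ] using hcov.tc2 s 1
    refine ⟨⟨fun s a => star_mul_map_of_mul_mul_star (hβ s) (hL s) (hcov.tc2 s) (h₃ s) a,
      fun s a => ?_⟩, fun s a => ?_⟩
    · change star (star (V s)) * π a * star (V s) = π (L s a)
      rw [star_star, h₃]
    · change π a = π a * star (V s) * star (star (V s))
      rw [star_star, mul_assoc, hiso, mul_one]
  · rintro ⟨π, V⟩ - ⟨π', V'⟩ - h
    obtain ⟨rfl, h₂⟩ := Prod.mk.inj h
    congr 1
    ext1 s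
    exact star_injective (DFunLike.congr_fun h₂ s)
  · rintro ⟨π, W⟩ ⟨hcov, h₃⟩
    -- As `π` is unital, the case `a = 1` already makes every `W s` a coisometry.
    have hco : ∀ s, W s * star (W s) = 1 := fun s => by simpa using (h₃ s 1).symm
    refine ⟨(π, adjointRep W), ⟨⟨fun s a => ?_, fun s a => ?_⟩, fun s a => ?_⟩, ?_⟩
    · exact star_mul_map_of_mul_star_eq_one (hcov.tc2 s) (hco s) a
    · change star (star (W s)) * π a * star (W s) = π (β s a)
      rw [star_star]
      exact mul_map_mul_star_of_mul_star_eq_one (hcov.tc1 s) (hco s) a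
    · change star (W s) * π a * star (star (W s)) = π (L s a)
      rw [star_star]
      exact hcov.tc2 s a
    · refine Prod.ext rfl (MonoidHom.ext fun s => star_star (W s))

theorem mainTheorem1 {A : Type u} [CStarAlgebra A] {S : Type v} [CommMonoid S]
    (β L : S →* (A →⋆ₙₐ[ℂ] A))
    (hβ : ∀ s, β s 1 = 1)
    (hL : ∀ s, IsTransferOperator (β s) (L s))
    (hβL : ∀ s a, β s (L s a) = a) :
    (∀ s, IsTransferOperator (L s) (β s)) ∧
    (∀ (H : Type w) [NormedAddCommGroup H] [InnerProductSpace ℂ H] [CompleteSpace H],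
      Set.BijOn
        (fun P : (A →⋆ₐ[ℂ] (H →L[ℂ] H)) × (S →* (H →L[ℂ] H)) => (P.1, adjointRep P.2))
        {P | IsToeplitzCovariant L (fun s => β s) P.1 P.2 ∧
          ∀ s a, P.2 s * P.1 a * star (P.2 s) = P.1 (L s a)}
        {P | IsToeplitzCovariant β (fun s => L s) P.1 P.2 ∧
          ∀ s a, P.1 a = P.1 a * P.2 s * star (P.2 s)}) ∧
    Nonempty (ToeplitzCrossedProduct L (fun s => β s)) ∧
    Nonempty (ToeplitzCrossedProduct β (fun s => L s)) ∧
    (∀ (T₁ : ToeplitzCrossedProduct L (fun s => β s))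
      (T₂ : ToeplitzCrossedProduct β (fun s => L s)),
      ∃ Φ : T₁.CrossedProduct ≃⋆ₐ[ℂ] T₂.CrossedProduct,
        (∀ x, ‖Φ x‖ = ‖x‖) ∧
        (∀ a, Φ (T₁.jA a) = T₂.jA a) ∧
        (∀ s, Φ (T₁.jS s) = star (T₂.jS s)) ∧
        (∀ (H : Type (max u v)) [NormedAddCommGroup H] [InnerProductSpace ℂ H] [CompleteSpace H]
          (π : A →⋆ₐ[ℂ] (H →L[ℂ] H)) (V : S →* (H →L[ℂ] H)),
          IsToeplitzCovariant L (fun s => β s) π V →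
          (∀ s a, V s * π a * star (V s) = π (L s a)) →
          ∃ (ρ₁ : T₁.CrossedProduct →⋆ₐ[ℂ] (H →L[ℂ] H))
            (ρ₂ : T₂.CrossedProduct →⋆ₐ[ℂ] (H →L[ℂ] H)),
            (∀ a, ρ₁ (T₁.jA a) = π a) ∧ (∀ s, ρ₁ (T₁.jS s) = V s) ∧
            (∀ a, ρ₂ (T₂.jA a) = π a) ∧ (∀ s, ρ₂ (T₂.jS s) = star (V s)) ∧
            ∀ x, ρ₂ (Φ x) = ρ₁ x)) := by
  exact ⟨fun s => NonUnitalStarAlgHom.isTransferOperator_of_leftInverse (hβL s),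
    fun H _ _ _ => bijOn_adjointRep hβ hL H,
    ToeplitzCrossedProduct.nonempty _ _, ToeplitzCrossedProduct.nonempty _ _,
    fun T₁ T₂ => T₁.exists_isometric_starAlgEquiv hβ hL hβL T₂⟩
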